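/- Let $f:\mathbb{C}\to\mathbb{C}$ be a transcendental entire function, with iterates $f^n$, $n\ge 0$. Its Fatou set is the set of points having a neighbourhood in which $(f^n)_{n\ge 0}$ is a normal family, and a Fatou component is a connected component of the Fatou set. For $r>0$ let $M(r)=\max_{|z|=r}|f(z)|$, and let $M^n$ denote the $n$-th iterate of $r\mapsto M(r)$. Let $R>0$ be such that $M(r)>r$ for all $r\ge R$. For $L\in\mathbb{Z}$ put $$A_R^L(f)=\{z\in\mathbb{C}: |f^n(z)|\ge M^{n+L}(R)\ \text{for all integers } n\ge 0 \text{ with } n+L\ge 0\},$$ and let $$A(f)=\{z\in\mathbb{C}: \text{there is an integer } L\ge 0 \text{ with } |f^{n+L}(z)|\ge M^{n}(R)\ \text{for all } n\ge 0\}$$ be the fast escaping set (it does not depend on the choice of $R$). Let $L\in\mathbb{Z}$ and let $U$ be a Fatou component of $f$ that meets $A_R^L(f)$. Then (a) $\overline{U}\subset A_R^{L-1}(f)$; (b) if, in addition, $U$ is simply connected, then $\overline{U}\subset A_R^{L}(f)$. In particular, if $U$ is a Fatou component with $U\subset A(f)$, then $\partial U\subset A(f)$. -/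

import Mathlib

open Filter Topology Set

/-- A transcendental entire function: holomorphic on all of `ℂ` and not a polynomial function. -/
def IsTranscendentalEntire (f : ℂ → ℂ) : Prop :=
  Differentiable ℂ f ∧ ¬ ∃ p : Polynomial ℂ, ∀ z, f z = p.eval z

/-- The sequence `F` tends to `∞` locally uniformly on the open set `V`. -/
def TendstoInftyLocallyUniformlyOn (F : ℕ → ℂ → ℂ) (V : Set ℂ) : Prop :=
  ∀ K : Set ℂ, K ⊆ V → IsCompact K → ∀ C : ℝ, ∀ᶠ k in atTop, ∀ z ∈ K, C ≤ ‖F k z‖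

/-- Normality (in the sense of Montel) on a domain `V` of a family `F` of holomorphic functions:
every sequence of members of the family has a subsequence that converges locally uniformly on `V`,
either to a finite limit function (which is then automatically holomorphic) or to `∞`. On a
connected open set this is the same as local uniform convergence in the spherical metric. -/
def IsNormalFamilyOn {ι : Type*} (F : ι → ℂ → ℂ) (V : Set ℂ) : Prop :=
  ∀ s : ℕ → ι, ∃ φ : ℕ → ℕ, StrictMono φ ∧
    ((∃ g : ℂ → ℂ, TendstoLocallyUniformlyOn (fun k => F (s (φ k))) g atTop V) ∨
      TendstoInftyLocallyUniformlyOn (fun k => F (s (φ k))) V)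

/-- The Fatou set: the points having a (connected, open) neighbourhood on which the iterates
of `f` form a normal family. -/
def fatouSet (f : ℂ → ℂ) : Set ℂ :=
  {z | ∃ V : Set ℂ, IsOpen V ∧ IsConnected V ∧ z ∈ V ∧ IsNormalFamilyOn (fun n : ℕ => f^[n]) V}

/-- A Fatou component: a connected component of the Fatou set. -/
def IsFatouComponent (f : ℂ → ℂ) (U : Set ℂ) : Prop :=
  ∃ z ∈ fatouSet f, U = connectedComponentIn (fatouSet f) z

/-- The maximum modulus `M(r, f) = max_{|z| = r} |f z|`, used for `r > 0` and continuous `f`. -/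
noncomputable def maxModulus (f : ℂ → ℂ) (r : ℝ) : ℝ :=
  sSup ((fun z => ‖f z‖) '' Metric.sphere (0 : ℂ) r)

/-- The `L`-th level `A_R^L(f)`: the points `z` with `|f^n(z)| ≥ M^{n+L}(R, f)` for all `n ≥ 0`
with `n + L ≥ 0`, where `M^k` is the `k`-th iterate of `r ↦ M(r, f)`. -/
def fastEscapingLevel (f : ℂ → ℂ) (R : ℝ) (L : ℤ) : Set ℂ :=
  {z | ∀ n : ℕ, 0 ≤ (n : ℤ) + L → (maxModulus f)^[((n : ℤ) + L).toNat] R ≤ ‖f^[n] z‖}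

/-- The fast escaping set `A(f)`, formed with the value `R`: the points `z` for which there is
`L ∈ ℕ` with `|f^{n+L}(z)| ≥ M^n(R, f)` for all `n ≥ 0`. -/
def fastEscapingSet (f : ℂ → ℂ) (R : ℝ) : Set ℂ :=
  {z | ∃ L : ℕ, ∀ n : ℕ, (maxModulus f)^[n] R ≤ ‖f^[n + L] z‖}

/-! Each level is closed, so it suffices to place `U` itself in the level; the statement on the
boundary then follows from (a).

For (a), one escaping point makes the iterates tend to infinity locally uniformly on `U`. Hence on
discs compactly inside `U` the functions log |f^n| are eventually positive and harmonic, and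
Harnack's inequality, chained through the connected set `U`, compares them at two points up to a
factor C independent of n. A point outside level L - 1 has an orbit strictly below some a = M^k(R),
while at the same time the given point of level L has modulus at least M(a). Since M(a) ≥ a^K for
large a, by transcendence, any K > C gives a contradiction.

For (b), the moduli themselves are compared. The logarithmic estimate also shows that f^n(U) never
meets `U` for n ≥ 1. Fix p outside the Fatou set. By Bloch's theorem, either f^n - p has bounded
distortion on a disc in `U`, or f^n(U) contains a large circle about p. In the second case
disjointness traps `U` inside that circle, so a level set of |f^n - p| in `U` is compact; this is
impossible on a simply connected domain, where f^n - p has a logarithm. So orbit moduli at two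
points of `U` have bounded ratio. But for an orbit below M^k(R), the quotient |f^k| / M^k(R) is at
most squared at each late step and tends to 0. -/

/-! ### Logarithms, Harnack and Bloch estimates -/

/-- A nonvanishing holomorphic function on a simply connected open set has a holomorphic
logarithm. -/
theorem exists_differentiableOn_exp_eq {U : Set ℂ} (hU : IsOpen U) (hsc : IsSimplyConnected U)
    {g : ℂ → ℂ} (hg : DifferentiableOn ℂ g U) (h0 : ∀ z ∈ U, g z ≠ 0) :
    ∃ h : ℂ → ℂ, DifferentiableOn ℂ h U ∧ ∀ z ∈ U, Complex.exp (h z) = g z := by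
  obtain ⟨h, hc, he⟩ := Complex.exists_continuousOn_eqOn_exp_comp hsc hU hg.continuousOn
    (by rintro ⟨z, hz, h⟩; exact h0 z hz h)
  refine ⟨h, fun z hz => ?_, fun z hz => he hz⟩
  have hcz : ContinuousAt h z := hc.continuousAt (hU.mem_nhds hz)
  have hgz : DifferentiableAt ℂ g z := hg.differentiableAt (hU.mem_nhds hz)
  -- Near `z` the continuous logarithm agrees with this principal-branch expression, because the
  -- imaginary part of `h w - h z` stays below 1 < π.
  have hd : DifferentiableAt ℂ (fun w => h z + Complex.log (g w / g z)) z := by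
    have : DifferentiableAt ℂ (fun w => g w / g z) z := hgz.div_const _
    refine (this.clog ?_).const_add _
    simp [div_self (h0 z hz)]
  have heq : h =ᶠ[𝓝 z] fun w => h z + Complex.log (g w / g z) := by
    have h1 : ∀ᶠ w in 𝓝 z, dist (h w) (h z) < 1 := hcz (Metric.ball_mem_nhds _ one_pos)
    filter_upwards [h1, hU.mem_nhds hz] with w hw hwU
    have e : g w / g z = Complex.exp (h w - h z) := by
      rw [Complex.exp_sub]
      exact congrArg₂ _ (he hwU).symm (he hz).symm
    have hi : |(h w - h z).im| < 1 :=
      (Complex.abs_im_le_norm _).trans_lt (by rwa [← dist_eq_norm])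
    have hpi := Real.pi_gt_three
    rw [abs_lt] at hi
    rw [e, Complex.log_exp (by linarith) (by linarith)]
    ring
  exact (hd.congr_of_eventuallyEq heq).differentiableWithinAt

theorem isSimplyConnected_ball (a : ℂ) {r : ℝ} (hr : 0 < r) :
    IsSimplyConnected (Metric.ball a r) := by
  have := (convex_ball a r).contractibleSpace ⟨a, Metric.mem_ball_self hr⟩
  exact SimplyConnectedSpace.ofContractible _

/-- **Harnack's inequality** for the real part of a holomorphic function on a disc. -/
theorem harnack_re {h : ℂ → ℂ} {a : ℂ} {r : ℝ}
    (hd : DifferentiableOn ℂ h (Metric.ball a r)) (hpos : ∀ z ∈ Metric.ball a r, 0 < (h z).re)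
    {z : ℂ} (hz : z ∈ Metric.ball a (r / 2)) :
    (h z).re ≤ 3 * (h a).re ∧ (h a).re ≤ 3 * (h z).re := by
  have hr : 0 < r / 2 := Metric.pos_of_mem_ball hz
  have hzr : z ∈ Metric.ball a r := Metric.ball_subset_ball (by linarith) hz
  have ha : a ∈ Metric.ball a r := Metric.mem_ball_self (by linarith)
  set c : ℂ := h a with hc
  have hcpos : 0 < c.re := hpos a ha
  have hne : ∀ w ∈ Metric.ball a r, h w + starRingEnd ℂ c ≠ 0 := by
    intro w hw h0
    have := congrArg Complex.re h0
    simp at this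
    linarith [hpos w hw]
  have hle : ∀ w : ℂ, 0 < w.re → ‖w - c‖ ≤ ‖w + starRingEnd ℂ c‖ := by
    intro w hw
    rw [← sq_le_sq₀ (norm_nonneg _) (norm_nonneg _), Complex.sq_norm, Complex.sq_norm,
      Complex.normSq_apply, Complex.normSq_apply]
    simp
    nlinarith [mul_pos hw hcpos]
  -- This is `h` followed by the Cayley transform of the right half-plane sending `c` to 0.
  -- Schwarz's lemma bounds it by 1/2 on the half disc, and the two triangle inequalities `n1`, `n2`
  -- turn that into the factor 3.
  let φ : ℂ → ℂ := fun w => (h w - c) / (h w + starRingEnd ℂ c)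
  have hφd : DifferentiableOn ℂ φ (Metric.ball a r) :=
    (hd.sub_const _).div (hd.add_const _) hne
  have hφa : φ a = 0 := by simp [φ, hc]
  have hφ := Complex.dist_le_div_mul_dist_of_mapsTo_ball (R₂ := 1) hφd (by
    intro w hw
    rw [hφa, mem_closedBall_zero_iff, norm_div]
    exact div_le_one_of_le₀ (hle _ (hpos w hw)) (norm_nonneg _)) hzr
  rw [hφa, dist_zero_right] at hφ
  have hφ2 : ‖φ z‖ ≤ 1 / 2 := by
    refine hφ.trans ?_
    have : dist z a < r / 2 := hz
    rw [div_mul_eq_mul_div, div_le_iff₀ (by linarith)]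
    linarith
  have key : ‖h z - c‖ ≤ 1 / 2 * ‖h z + starRingEnd ℂ c‖ := by
    have h1 : 0 < ‖h z + starRingEnd ℂ c‖ := norm_pos_iff.mpr (hne z hzr)
    simpa [φ, norm_div, div_le_iff₀ h1] using hφ2
  have hz0 := hpos z hzr
  have n1 : ‖h z + starRingEnd ℂ c‖ ≤ ‖h z - c‖ + 2 * c.re := by
    have e : h z + starRingEnd ℂ c = (h z - c) + ((2 * c.re : ℝ) : ℂ) := by
      rw [← Complex.add_conj]; ring
    rw [e]
    refine (norm_add_le _ _).trans ?_
    rw [Complex.norm_real, Real.norm_of_nonneg (by linarith)]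
  have n2 : ‖h z + starRingEnd ℂ c‖ ≤ ‖h z - c‖ + 2 * (h z).re := by
    have e : h z + starRingEnd ℂ c = ((2 * (h z).re : ℝ) : ℂ) - starRingEnd ℂ (h z - c) := by
      rw [← Complex.add_conj, map_sub]; ring
    rw [e]
    refine (norm_sub_le _ _).trans ?_
    rw [Complex.norm_real, Real.norm_of_nonneg (by linarith), Complex.norm_conj]
    linarith
  have hre := abs_le.mp (Complex.abs_re_le_norm (h z - c))
  rw [Complex.sub_re] at hre
  constructor <;> linarith [hre.1, hre.2]

/-- A weak form of **Bloch's theorem**. -/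
theorem exists_ball_subset_image_of_deriv {h : ℂ → ℂ} {a : ℂ} {r : ℝ} (hr : 0 < r)
    {V : Set ℂ} (hVo : IsOpen V) (hVs : Metric.closedBall a r ⊆ V) (hVd : DifferentiableOn ℂ h V)
    (ha : deriv h a ≠ 0) :
    ∃ z ∈ Metric.ball a r,
      Metric.ball (h z) (r * ‖deriv h a‖ / 48) ⊆ h '' Metric.ball a r := by
  have hd' : DifferentiableOn ℂ (deriv h) V := hVd.deriv hVo
  have hcont : ContinuousOn (fun z => ‖deriv h z‖ * (r - dist z a)) (Metric.closedBall a r) :=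
    (hd'.continuousOn.mono hVs).norm.mul (by fun_prop)
  -- Weighting |h'| by the distance to the boundary circle forces |h'| ≤ 2m on the disc about `z₀`
  -- whose radius δ is half the distance from `z₀` to that circle.
  obtain ⟨z₀, hz₀, hmax⟩ := (isCompact_closedBall a r).exists_isMaxOn
    ⟨a, Metric.mem_closedBall_self hr.le⟩ hcont
  have hbig : r * ‖deriv h a‖ ≤ ‖deriv h z₀‖ * (r - dist z₀ a) := by
    have := hmax (Metric.mem_closedBall_self hr.le)
    simp at this
    linarith
  have hpos : 0 < ‖deriv h z₀‖ * (r - dist z₀ a) :=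
    (mul_pos hr (norm_pos_iff.mpr ha)).trans_le hbig
  have hm : 0 < ‖deriv h z₀‖ := by
    by_contra hcon
    have : ‖deriv h z₀‖ = 0 := le_antisymm (not_lt.mp hcon) (norm_nonneg _)
    simp [this] at hpos
  have hδ : 0 < r - dist z₀ a := pos_of_mul_pos_right hpos hm.le
  set m := ‖deriv h z₀‖ with hmdef
  set δ := (r - dist z₀ a) / 2 with hδdef
  have hδ0 : 0 < δ := by positivity
  have hsub : Metric.ball z₀ δ ⊆ Metric.ball a r := by
    intro z hz
    have := dist_triangle z z₀ a
    rw [Metric.mem_ball] at *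
    linarith
  have hder : ∀ z ∈ Metric.ball z₀ δ, ‖deriv h z‖ ≤ 2 * m := by
    intro z hz
    have h1 : ‖deriv h z‖ * (r - dist z a) ≤ m * (r - dist z₀ a) :=
      hmax (Metric.ball_subset_closedBall (hsub hz))
    have h2 : δ ≤ r - dist z a := by
      have := dist_triangle z z₀ a
      rw [Metric.mem_ball] at hz
      linarith
    have h3 : ‖deriv h z‖ * δ ≤ 2 * m * δ :=
      (mul_le_mul_of_nonneg_left h2 (norm_nonneg _)).trans (h1.trans (by rw [hδdef]; linarith))
    exact le_of_mul_le_mul_right h3 hδ0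
  -- By Schwarz's lemma for h', its oscillation is at most m/2 within δ/6, so `h` expands distances
  -- from `z₀` by at least m/2. The quantitative open mapping theorem then covers radius
  -- (m/2)(δ/6)/2 = mδ/24, which is at least r|h'(a)|/48 by `hbig`.
  have hosc : ∀ z ∈ Metric.ball z₀ δ, ‖deriv h z - deriv h z₀‖ ≤ 3 * m / δ * dist z z₀ := by
    intro z hz
    rw [← dist_eq_norm]
    refine Complex.dist_le_div_mul_dist_of_mapsTo_ball
      (hd'.mono (hsub.trans (Metric.ball_subset_closedBall.trans hVs))) ?_ hz
    intro w hw
    rw [Metric.mem_closedBall, dist_eq_norm]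
    refine (norm_sub_le _ _).trans ?_
    linarith [hder w hw]
  have hcl : Metric.closedBall z₀ (δ / 6) ⊆ Metric.ball z₀ δ :=
    Metric.closedBall_subset_ball (by linarith)
  have hdiff : ∀ z ∈ Metric.closedBall z₀ (δ / 6), DifferentiableAt ℂ h z := fun z hz =>
    hVd.differentiableAt (hVo.mem_nhds (hVs (Metric.ball_subset_closedBall (hsub (hcl hz)))))
  have hlow : ∀ z ∈ Metric.closedBall z₀ (δ / 6), m / 2 * dist z z₀ ≤ ‖h z - h z₀‖ := by
    intro z hz
    have h1 := Convex.norm_image_sub_le_of_norm_deriv_le (𝕜 := ℂ)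
      (f := fun w => h w - deriv h z₀ * w) (s := Metric.closedBall z₀ (δ / 6)) (C := m / 2)
      (fun w hw => (hdiff w hw).sub (by fun_prop))
      (fun w hw => by
        have e : deriv (fun w => h w - deriv h z₀ * w) w = deriv h w - deriv h z₀ := by
          rw [deriv_fun_sub (hdiff w hw) (by fun_prop)]
          simp
        rw [e]
        refine (hosc w (hcl hw)).trans ?_
        have : dist w z₀ ≤ δ / 6 := hw
        calc 3 * m / δ * dist w z₀ ≤ 3 * m / δ * (δ / 6) := by gcongr
          _ = m / 2 := by field_simp; norm_num)
      (convex_closedBall _ _) (Metric.mem_closedBall_self (by linarith)) hz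
    have h2 : h z - h z₀ = (h z - deriv h z₀ * z - (h z₀ - deriv h z₀ * z₀))
        + deriv h z₀ * (z - z₀) := by ring
    have h3 : ‖deriv h z₀ * (z - z₀)‖ = m * dist z z₀ := by rw [norm_mul, dist_eq_norm]
    have h4 := norm_sub_le (h z - h z₀) (h z - deriv h z₀ * z - (h z₀ - deriv h z₀ * z₀))
    have h5 : h z - h z₀ - (h z - deriv h z₀ * z - (h z₀ - deriv h z₀ * z₀))
      = deriv h z₀ * (z - z₀) := by ring
    rw [h5, h3] at h4
    rw [← dist_eq_norm z z₀] at h1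
    linarith
  refine ⟨z₀, hsub (Metric.mem_ball_self hδ0), ?_⟩
  have hfin := DiffContOnCl.ball_subset_image_closedBall (f := h) (z₀ := z₀) (r := δ / 6)
    (ε := m * δ / 12)
    (DifferentiableOn.diffContOnCl (by
      intro z hz
      exact (hdiff z (Metric.closure_ball_subset_closedBall hz)).differentiableWithinAt))
    (by linarith)
    (by
      intro z hz
      have h1 := hlow z (Metric.sphere_subset_closedBall hz)
      rw [Metric.mem_sphere] at hz
      rw [hz] at h1
      linarith)
    (by
      have hf : ∃ᶠ z in 𝓝 z₀, z ≠ z₀ :=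
        (eventually_mem_nhdsWithin (a := z₀) (s := {z₀}ᶜ)).frequently.filter_mono
          nhdsWithin_le_nhds
      refine (hf.and_eventually (Metric.closedBall_mem_nhds z₀ (by linarith : 0 < δ / 6))).mono ?_
      rintro z ⟨hz1, hz2⟩ hz3
      have := hlow z hz2
      rw [hz3, sub_self, norm_zero] at this
      have := dist_pos.mpr hz1
      have := mul_pos hm this
      linarith)
  refine (Metric.ball_subset_ball ?_).trans (hfin.trans (image_mono (hcl.trans hsub)))
  rw [hδdef]
  linarith

/-- A nonvanishing holomorphic function on a disc either covers a circle centred at the origin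
or has bounded distortion on a smaller disc. -/
theorem sphere_subset_image_or_norm_le {g : ℂ → ℂ} {a : ℂ} {r : ℝ} (hr : 0 < r)
    (hg : DifferentiableOn ℂ g (Metric.ball a (2 * r)))
    (h0 : ∀ z ∈ Metric.ball a (2 * r), g z ≠ 0) :
    (∃ z ∈ Metric.ball a (2 * r), Metric.sphere 0 ‖g z‖ ⊆ g '' Metric.ball a (2 * r)) ∨
      ∀ b ∈ Metric.ball a r, ‖g b‖ ≤ Real.exp 384 * ‖g a‖ ∧ ‖g a‖ ≤ Real.exp 384 * ‖g b‖ := by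
  obtain ⟨h, hd, he⟩ := exists_differentiableOn_exp_eq Metric.isOpen_ball
    (isSimplyConnected_ball a (by linarith)) hg h0
  have hda : ∀ z ∈ Metric.ball a (2 * r), DifferentiableAt ℂ h z := fun z hz =>
    hd.differentiableAt (Metric.isOpen_ball.mem_nhds hz)
  have har : Metric.ball a r ⊆ Metric.ball a (2 * r) := Metric.ball_subset_ball (by linarith)
  -- The constant is 384 = 4 · 96: Bloch on radius r/2 yields a disc of radius greater than 4 > π in
  -- the image of `h`. Its vertical segment of half-length π exponentiates to a full circle.
  by_cases hbig : ∃ b ∈ Metric.ball a r, 384 / r < ‖deriv h b‖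
  · left
    obtain ⟨b, hb, hbd⟩ := hbig
    have hbpos : 0 < ‖deriv h b‖ := lt_trans (by positivity) hbd
    have hsub : Metric.closedBall b (r / 2) ⊆ Metric.ball a (2 * r) := by
      intro z hz
      have := dist_triangle z b a
      rw [Metric.mem_ball] at *
      rw [Metric.mem_closedBall] at hz
      linarith
    obtain ⟨z, hz, hball⟩ := exists_ball_subset_image_of_deriv (h := h) (half_pos hr)
      Metric.isOpen_ball hsub hd (norm_pos_iff.mp hbpos)
    have hzU := hsub (Metric.ball_subset_closedBall hz)
    refine ⟨z, hzU, fun w hw => ?_⟩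
    have hgz := h0 z hzU
    have hwn : ‖w‖ = ‖g z‖ := by simpa using hw
    have hq : ‖w / g z‖ = 1 := by rw [norm_div, hwn, div_self (norm_ne_zero_iff.mpr hgz)]
    have hmem : h z + (Complex.arg (w / g z) : ℂ) * Complex.I ∈
        Metric.ball (h z) (r / 2 * ‖deriv h b‖ / 48) := by
      rw [Metric.mem_ball, dist_eq_norm, add_sub_cancel_left, norm_mul, Complex.norm_I, mul_one,
        Complex.norm_real, Real.norm_eq_abs]
      have h1 := Complex.abs_arg_le_pi (w / g z)
      have h2 := Real.pi_lt_four
      rw [div_lt_iff₀ hr] at hbd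
      linarith
    obtain ⟨y, hy, hyz⟩ := hball hmem
    have hyU := hsub (Metric.ball_subset_closedBall hy)
    refine ⟨y, hyU, ?_⟩
    rw [← he y hyU, hyz, Complex.exp_add, he z hzU]
    have h3 := Complex.norm_mul_exp_arg_mul_I (w / g z)
    rw [hq, Complex.ofReal_one, one_mul] at h3
    rw [h3, mul_div_cancel₀ _ hgz]
  · right
    push Not at hbig
    intro b hb
    have ha : a ∈ Metric.ball a r := Metric.mem_ball_self hr
    have h1 := Convex.norm_image_sub_le_of_norm_deriv_le (fun w hw => hda w (har hw)) hbig
      (convex_ball a r) ha hb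
    have h2 : ‖h b - h a‖ ≤ 384 := by
      refine h1.trans ?_
      rw [← dist_eq_norm]
      have : dist b a < r := hb
      calc 384 / r * dist b a ≤ 384 / r * r := by gcongr
        _ = 384 := by field_simp
    have h3 := abs_le.mp ((Complex.abs_re_le_norm _).trans h2)
    rw [Complex.sub_re] at h3
    rw [← he b (har hb), ← he a (har ha), Complex.norm_exp, Complex.norm_exp, ← Real.exp_add,
      ← Real.exp_add, Real.exp_le_exp, Real.exp_le_exp]
    constructor <;> linarith [h3.1, h3.2]

/-- Level sets of the modulus of a nonvanishing holomorphic function on a simply connected domain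
are never compact. -/
theorem not_isCompact_norm_level {U : Set ℂ} (hU : IsOpen U) (hsc : IsSimplyConnected U)
    {g : ℂ → ℂ} (hg : DifferentiableOn ℂ g U) (h0 : ∀ z ∈ U, g z ≠ 0) {s : ℝ}
    (hne : {z ∈ U | ‖g z‖ = s}.Nonempty) : ¬ IsCompact {z ∈ U | ‖g z‖ = s} := by
  intro hK
  obtain ⟨h, hd, he⟩ := exists_differentiableOn_exp_eq hU hsc hg h0
  have hs : ∀ z ∈ U, ‖g z‖ = Real.exp (h z).re := fun z hz => by
    rw [← he z hz, Complex.norm_exp]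
  -- The level set is a level set of Re h, so an open `h` could move vertically from `h w` and
  -- exceed the maximum of Im h. If `h` is constant, the level set is all of `U`, which would be
  -- clopen and compact.
  obtain ⟨w, hw, hmax⟩ := hK.exists_isMaxOn hne
    (f := fun z => (h z).im) (Complex.continuous_im.comp_continuousOn
      (hd.continuousOn.mono fun z hz => hz.1))
  rcases (hd.analyticOnNhd hU).is_constant_or_isOpen
    hsc.isPathConnected.isConnected.isPreconnected with ⟨c, hc⟩ | ho
  · have hUK : {z ∈ U | ‖g z‖ = s} = U := by
      refine Subset.antisymm (fun z hz => hz.1) fun z hz => ⟨hz, ?_⟩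
      rw [← hw.2, hs z hz, hs w hw.1, hc z hz, hc w hw.1]
    rw [hUK] at hK
    have huniv := IsClopen.eq_univ ⟨hK.isClosed, hU⟩ ⟨w, hw.1⟩
    rw [huniv] at hK
    exact noncompact_univ ℂ hK
  · have hn := (ho U Subset.rfl hU).mem_nhds (mem_image_of_mem h hw.1)
    obtain ⟨ε, hε, hball⟩ := Metric.mem_nhds_iff.mp hn
    obtain ⟨z, hz, hzw⟩ := hball (show h w + ((ε / 2 : ℝ) : ℂ) * Complex.I ∈ _ by
      rw [Metric.mem_ball, dist_eq_norm, add_sub_cancel_left, norm_mul, Complex.norm_I, mul_one,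
        Complex.norm_real, Real.norm_of_nonneg (by linarith)]
      linarith)
    have hzK : z ∈ {z ∈ U | ‖g z‖ = s} := ⟨hz, by
      rw [← hw.2, hs z hz, hs w hw.1, hzw]; simp⟩
    have : (h z).im ≤ (h w).im := hmax hzK
    rw [hzw] at this
    simp at this
    linarith

/-! ### Growth of the maximum modulus -/

theorem exists_norm_eq_maxModulus {f : ℂ → ℂ} (hf : Continuous f) {r : ℝ} (hr : 0 ≤ r) :
    ∃ z, ‖z‖ = r ∧ ‖f z‖ = maxModulus f r := by
  have hne : (Metric.sphere (0 : ℂ) r).Nonempty := NormedSpace.sphere_nonempty.mpr hr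
  obtain ⟨z, hz, h⟩ := (isCompact_sphere (0 : ℂ) r).exists_sSup_image_eq hne
    (f := fun z => ‖f z‖) hf.norm.continuousOn
  exact ⟨z, by simpa using hz, h.symm⟩

theorem norm_le_maxModulus {f : ℂ → ℂ} (hf : Continuous f) (z : ℂ) :
    ‖f z‖ ≤ maxModulus f ‖z‖ :=
  le_csSup ((isCompact_sphere (0 : ℂ) ‖z‖).image hf.norm).bddAbove ⟨z, by simp, rfl⟩

theorem norm_le_maxModulus_of_norm_le {f : ℂ → ℂ} (hf : Differentiable ℂ f) {z : ℂ} {r : ℝ}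
    (h : ‖z‖ ≤ r) : ‖f z‖ ≤ maxModulus f r := by
  rcases h.eq_or_lt with rfl | h
  · exact norm_le_maxModulus hf.continuous z
  · refine Complex.norm_le_of_forall_mem_frontier_norm_le (U := Metric.ball 0 r)
      Metric.isBounded_ball hf.diffContOnCl (fun w hw => ?_) (subset_closure (by simpa using h))
    have hw' : ‖w‖ = r := by
      simpa using Metric.frontier_ball_subset_sphere hw
    exact hw' ▸ norm_le_maxModulus hf.continuous w

/-- The image of the open disc is open, hence lies in the interior of the closed disc of radius
M(r). Strictness keeps an orbit strictly below the iterates of M once it is below. -/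
theorem norm_lt_maxModulus_of_norm_lt {f : ℂ → ℂ} (hf : Differentiable ℂ f) (ho : IsOpenMap f)
    {z : ℂ} {r : ℝ} (h : ‖z‖ < r) : ‖f z‖ < maxModulus f r := by
  have hsub : f '' Metric.ball 0 r ⊆ Metric.closedBall 0 (maxModulus f r) := by
    rintro _ ⟨w, hw, rfl⟩
    simpa using norm_le_maxModulus_of_norm_le hf (mem_ball_zero_iff.mp hw).le
  have h1 := interior_maximal hsub (ho _ Metric.isOpen_ball)
    (mem_image_of_mem f (mem_ball_zero_iff.mpr h))
  have hne : maxModulus f r ≠ 0 := by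
    rintro h0
    rw [h0, Metric.closedBall_zero, interior_singleton] at h1
    exact h1
  rw [interior_closedBall _ hne] at h1
  simpa using h1

theorem IsTranscendentalEntire.isOpenMap {f : ℂ → ℂ} (hf : IsTranscendentalEntire f) :
    IsOpenMap f := by
  rcases AnalyticOnNhd.is_constant_or_isOpen (U := univ)
    (fun z _ => hf.1.analyticAt z) isPreconnected_univ with ⟨c, hc⟩ | h
  · exact absurd ⟨Polynomial.C c, fun z => by simpa using hc z (mem_univ z)⟩ hf.2
  · exact fun s hs => h s (subset_univ s) hs

/-- The maximum modulus of a transcendental entire function outgrows every power. -/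
theorem IsTranscendentalEntire.eventually_pow_le_maxModulus {f : ℂ → ℂ}
    (hf : IsTranscendentalEntire f) (K : ℕ) : ∀ᶠ r in atTop, r ^ K ≤ maxModulus f r := by
  by_contra hcon
  rw [not_eventually] at hcon
  refine hf.2 ?_
  -- Cauchy's estimates along the arbitrarily large radii with M(r) < r^K kill all Taylor
  -- coefficients beyond degree K.
  have hzero : ∀ n, K + 1 ≤ n → iteratedDeriv n f 0 = 0 := by
    intro n hn
    have hbound : ∃ᶠ r : ℝ in atTop, ‖iteratedDeriv n f 0‖ ≤ n.factorial * r⁻¹ := by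
      refine (hcon.and_eventually (eventually_ge_atTop 1)).mono ?_
      rintro r ⟨hr, hr1⟩
      have hr0 : 0 < r := by linarith
      refine (Complex.norm_iteratedDeriv_le_of_forall_mem_sphere_norm_le n hr0
        hf.1.diffContOnCl (C := r ^ K) fun z hz => ?_).trans ?_
      · exact (norm_le_maxModulus_of_norm_le hf.1 (by simpa using hz.le)).trans (not_le.mp hr).le
      · rw [mul_div_assoc]
        gcongr
        rw [div_le_iff₀ (by positivity), inv_mul_eq_div, le_div_iff₀ hr0, ← pow_succ]
        exact pow_le_pow_right₀ hr1 hn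
    have hlim : Tendsto (fun r : ℝ => (n.factorial : ℝ) * r⁻¹) atTop (𝓝 0) := by
      simpa using tendsto_inv_atTop_zero.const_mul (n.factorial : ℝ)
    rw [← norm_le_zero_iff]
    by_contra hpos
    obtain ⟨r, h1, h2⟩ := (hbound.and_eventually
      (hlim.eventually (gt_mem_nhds (not_le.mp hpos)))).exists
    linarith
  refine ⟨∑ n ∈ Finset.range (K + 1),
    Polynomial.monomial n ((n.factorial : ℂ)⁻¹ * iteratedDeriv n f 0), fun z => ?_⟩
  rw [← Complex.taylorSeries_eq_of_entire' 0 z hf.1, tsum_eq_sum (s := Finset.range (K + 1)),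
    Polynomial.eval_finsetSum]
  · simp [Polynomial.eval_monomial]
  · intro n hn
    rw [hzero n (by simpa using hn)]
    simp

/-- For large radii, the maximum modulus of a transcendental entire function grows at least
quadratically relative to its values at all smaller points outside the unit disc. -/
theorem IsTranscendentalEntire.eventually_sq_mul_norm_le {f : ℂ → ℂ}
    (hf : IsTranscendentalEntire f) :
    ∀ᶠ x in atTop, ∀ z : ℂ, 1 ≤ ‖z‖ → ‖z‖ ≤ x →
      x ^ 2 * ‖f z‖ ≤ ‖z‖ ^ 2 * maxModulus f x := by
  filter_upwards [hf.eventually_pow_le_maxModulus 3, eventually_ge_atTop (maxModulus f 1),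
    eventually_ge_atTop 1] with x hx3 hx1 hx z hz1 hzx
  have hx0 : 0 < x := by linarith
  -- Maximum principle for f(w)/w² on the annulus 1 < |w| < x. The inner circle is harmless because
  -- M(1) ≤ x and x³ ≤ M(x), which is why the exponent 3 is used.
  set U : Set ℂ := Metric.ball 0 x ∩ (Metric.closedBall 0 1)ᶜ with hU
  have hUo : IsOpen U := Metric.isOpen_ball.inter Metric.isClosed_closedBall.isOpen_compl
  have hcl : closure U ⊆ {w | 1 ≤ ‖w‖ ∧ ‖w‖ ≤ x} := by
    refine closure_minimal ?_ ((isClosed_le continuous_const continuous_norm).inter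
      (isClosed_le continuous_norm continuous_const))
    rintro w ⟨h1, h2⟩
    simp only [Metric.mem_ball, dist_zero_right, mem_compl_iff, Metric.mem_closedBall, not_le]
      at h1 h2
    exact ⟨h2.le, h1.le⟩
  have hbd : ∀ w, ‖w‖ = 1 ∨ ‖w‖ = x → ‖f w / w ^ 2‖ ≤ maxModulus f x / x ^ 2 := by
    intro w hw
    rw [norm_div, norm_pow]
    rcases hw with hw | hw
    · rw [hw, one_pow, div_one, le_div_iff₀ (by positivity)]
      have h1 : ‖f w‖ ≤ x := (hw ▸ norm_le_maxModulus hf.1.continuous w).trans hx1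
      calc ‖f w‖ * x ^ 2 ≤ x * x ^ 2 := by gcongr
        _ = x ^ 3 := by ring
        _ ≤ _ := hx3
    · rw [hw]
      gcongr
      exact hw ▸ norm_le_maxModulus hf.1.continuous w
  suffices h : ‖f z / z ^ 2‖ ≤ maxModulus f x / x ^ 2 by
    rw [norm_div, norm_pow, div_le_div_iff₀ (by positivity) (by positivity)] at h
    linarith
  by_cases hzb : ‖z‖ = 1 ∨ ‖z‖ = x
  · exact hbd z hzb
  push Not at hzb
  refine Complex.norm_le_of_forall_mem_frontier_norm_le (U := U) (f := fun w => f w / w ^ 2)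
    (Metric.isBounded_ball.subset inter_subset_left) ?_ ?_ (subset_closure ?_)
  · refine DifferentiableOn.diffContOnCl fun w hw => ?_
    have hw0 : w ≠ 0 := by
      rintro rfl
      have := (hcl hw).1
      norm_num at this
    have hd : DifferentiableAt ℂ (fun w : ℂ => w ^ 2) w := by fun_prop
    exact ((hf.1 w).fun_div hd (pow_ne_zero 2 hw0)).differentiableWithinAt
  · intro w hw
    refine hbd w ?_
    obtain ⟨h1, h2⟩ := hcl hw.1
    by_contra hcon
    push Not at hcon
    refine hw.2 ?_
    rw [hUo.interior_eq]
    refine ⟨by simpa using lt_of_le_of_ne h2 hcon.2, ?_⟩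
    simpa using lt_of_le_of_ne h1 hcon.1.symm
  · refine ⟨by simpa using lt_of_le_of_ne hzx hzb.2, ?_⟩
    simpa using lt_of_le_of_ne hz1 hzb.1.symm

section Iterates

variable {f : ℂ → ℂ} {R : ℝ}

theorem le_maxModulus_iterate (hM : ∀ r : ℝ, R ≤ r → r < maxModulus f r) (n : ℕ) :
    R ≤ (maxModulus f)^[n] R := by
  induction n with
  | zero => exact le_rfl
  | succ n ih =>
    rw [Function.iterate_succ_apply']
    exact ih.trans (hM _ ih).le

theorem monotone_maxModulus_iterate (hM : ∀ r : ℝ, R ≤ r → r < maxModulus f r) :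
    Monotone fun n : ℕ => (maxModulus f)^[n] R := by
  refine monotone_nat_of_le_succ fun n => ?_
  simp only [Function.iterate_succ_apply']
  exact (hM _ (le_maxModulus_iterate hM n)).le

/-- A finite limit l would have M(l) > l. Scaling a maximum point on |z| = l down to the radii
M^n(R), continuity of `f` gives M^{n+1}(R) > l for some n, a contradiction. -/
theorem tendsto_maxModulus_iterate (hf : Differentiable ℂ f) (hR : 0 < R)
    (hM : ∀ r : ℝ, R ≤ r → r < maxModulus f r) :
    Tendsto (fun n : ℕ => (maxModulus f)^[n] R) atTop atTop := by
  rcases tendsto_atTop_of_monotone (monotone_maxModulus_iterate hM) with h | ⟨l, hl⟩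
  · exact h
  exfalso
  have hle : ∀ n, (maxModulus f)^[n] R ≤ l := (monotone_maxModulus_iterate hM).ge_of_tendsto hl
  have hRl : R ≤ l := hle 0
  have hl0 : 0 < l := hR.trans_le hRl
  obtain ⟨z, hz, hfz⟩ := exists_norm_eq_maxModulus hf.continuous hl0.le
  have hcont : Tendsto (fun n : ℕ => ‖f ((((maxModulus f)^[n] R / l : ℝ) : ℂ) * z)‖) atTop
      (𝓝 ‖f z‖) := by
    have h1 : Continuous fun x : ℝ => ‖f (((x / l : ℝ) : ℂ) * z)‖ := by
      have := hf.continuous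
      fun_prop
    have h2 := (h1.tendsto l).comp hl
    simpa [Function.comp_def, div_self hl0.ne', hl0.ne'] using h2
  obtain ⟨n, hn⟩ := (hcont.eventually (lt_mem_nhds (hfz ▸ hM l hRl))).exists
  have hpos : 0 < (maxModulus f)^[n] R := hR.trans_le (le_maxModulus_iterate hM n)
  have h3 := norm_le_maxModulus hf.continuous ((((maxModulus f)^[n] R / l : ℝ) : ℂ) * z)
  rw [norm_mul, Complex.norm_real, Real.norm_of_nonneg (by positivity), hz,
    div_mul_cancel₀ _ hl0.ne', ← Function.iterate_succ_apply' (maxModulus f)] at h3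
  linarith [hle (n + 1)]

theorem norm_iterate_lt_maxModulus_iterate (hf : Differentiable ℂ f) (ho : IsOpenMap f)
    {z : ℂ} {r : ℝ} (h : ‖z‖ < r) (n : ℕ) : ‖f^[n] z‖ < (maxModulus f)^[n] r := by
  induction n with
  | zero => exact h
  | succ n ih =>
    rw [Function.iterate_succ_apply', Function.iterate_succ_apply']
    exact norm_lt_maxModulus_of_norm_lt hf ho ih

theorem isClosed_fastEscapingLevel (hf : Continuous f) (R : ℝ) (L : ℤ) :
    IsClosed (fastEscapingLevel f R L) := by
  simp only [fastEscapingLevel, Set.ofPred_forall]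
  exact isClosed_iInter fun n => isClosed_iInter fun _ =>
    isClosed_le continuous_const (hf.iterate n).norm

end Iterates

/-! ### Invariance of the Fatou set and normality -/

theorem isOpen_fatouSet (f : ℂ → ℂ) : IsOpen (fatouSet f) := by
  rw [isOpen_iff_mem_nhds]
  rintro z ⟨V, hVo, hVc, hz, hV⟩
  exact mem_of_superset (hVo.mem_nhds hz) fun w hw => ⟨V, hVo, hVc, hw, hV⟩

/-- The Fatou set is backward invariant. -/
theorem mem_fatouSet_of_map_mem {f : ℂ → ℂ} (hf : Continuous f) {z : ℂ}
    (h : f z ∈ fatouSet f) : z ∈ fatouSet f := by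
  obtain ⟨V, hVo, -, hz, hV⟩ := h
  obtain ⟨r, hr, hball⟩ := Metric.isOpen_iff.mp (hVo.preimage hf) z hz
  refine ⟨Metric.ball z r, Metric.isOpen_ball,
    ⟨⟨z, Metric.mem_ball_self hr⟩, (convex_ball z r).isPreconnected⟩, Metric.mem_ball_self hr, ?_⟩
  intro s
  -- The iterate of index 0 does not factor through `f`; if it recurs, it gives a constant
  -- subsequence.
  by_cases h0 : ∃ᶠ k in atTop, s k = 0
  · obtain ⟨φ, hφ, hs⟩ := extraction_of_frequently_atTop h0
    refine ⟨φ, hφ, Or.inl ⟨id, ?_⟩⟩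
    rw [Metric.tendstoLocallyUniformlyOn_iff]
    intro ε hε x _
    refine ⟨univ, univ_mem, Eventually.of_forall fun k y _ => ?_⟩
    simpa [hs k] using hε
  · rw [not_frequently, eventually_atTop] at h0
    obtain ⟨k₀, hk₀⟩ := h0
    obtain ⟨φ, hφ, hlim⟩ := hV fun k => s (k + k₀) - 1
    have he : ∀ k, f^[s (φ k + k₀)] = fun w => f^[s (φ k + k₀) - 1] (f w) := by
      intro k
      have hpos : s (φ k + k₀) ≠ 0 := hk₀ _ (Nat.le_add_left _ _)
      conv_lhs => rw [← Nat.sub_one_add_one hpos]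
      rfl
    refine ⟨fun k => φ k + k₀, fun a b hab => Nat.add_lt_add_right (hφ hab) _, ?_⟩
    rcases hlim with ⟨g, hg⟩ | hinf
    · left
      refine ⟨g ∘ f, ?_⟩
      have := hg.comp f (t := Metric.ball z r) (fun w hw => hball hw) hf.continuousOn
      refine this.congr fun k => ?_
      intro w _
      simp only [he k]
      rfl
    · right
      intro K hK hKc C
      have := hinf (f '' K) (image_subset_iff.mpr (hK.trans hball)) (hKc.image hf) C
      filter_upwards [this] with k hk w hw
      simp only [he k]
      exact hk _ (mem_image_of_mem f hw)

/-- The Fatou set is forward invariant. -/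
theorem map_mem_fatouSet {f : ℂ → ℂ} (hf : Continuous f) (ho : IsOpenMap f) {z : ℂ}
    (h : z ∈ fatouSet f) : f z ∈ fatouSet f := by
  obtain ⟨V, hVo, hVc, hz, hV⟩ := h
  refine ⟨f '' V, ho V hVo, hVc.image f hf.continuousOn, mem_image_of_mem f hz, ?_⟩
  intro s
  obtain ⟨φ, hφ, hlim⟩ := hV fun k => s k + 1
  refine ⟨φ, hφ, ?_⟩
  rcases hlim with ⟨g, hg⟩ | hinf
  · left
    choose! σ hσV hσ using fun (w : ℂ) (hw : w ∈ f '' V) => hw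
    refine ⟨g ∘ σ, ?_⟩
    -- Two preimages of the same point have the same later orbit, so the limit does not depend on
    -- the choice `σ`.
    have hlim : ∀ v ∈ V, g (σ (f v)) = g v := by
      intro v hv
      have h1 := hg.tendsto_at hv
      have h2 := hg.tendsto_at (hσV _ (mem_image_of_mem f hv))
      simp only [Function.iterate_succ_apply, hσ _ (mem_image_of_mem f hv)] at h1 h2
      exact tendsto_nhds_unique h2 h1
    rw [Metric.tendstoLocallyUniformlyOn_iff] at hg ⊢
    rintro ε hε _ ⟨v, hv, rfl⟩
    obtain ⟨t, ht, hu⟩ := hg ε hε v hv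
    rw [hVo.nhdsWithin_eq hv] at ht
    refine ⟨f '' (t ∩ V), mem_nhdsWithin_of_mem_nhds
      (ho.image_mem_nhds (inter_mem ht (hVo.mem_nhds hv))), ?_⟩
    filter_upwards [hu] with k hk
    rintro _ ⟨y, ⟨hyt, hyV⟩, rfl⟩
    simpa [hlim y hyV] using hk y hyt
  · right
    intro K hK hKc C
    refine hKc.induction_on (p := fun s' => ∀ᶠ k in atTop, ∀ w ∈ s', C ≤ ‖f^[s (φ k)] w‖)
      (by simp) (fun a b hab hb => ?_) (fun a b ha hb => ?_) fun w hw => ?_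
    · filter_upwards [hb] with k hk w hw using hk w (hab hw)
    · filter_upwards [ha, hb] with k h1 h2 w hw using hw.elim (h1 w) (h2 w)
    · obtain ⟨v, hv, rfl⟩ := hK hw
      obtain ⟨N, hN, hNV, hNc⟩ := LocallyCompactSpace.local_compact_nhds v V (hVo.mem_nhds hv)
      refine ⟨f '' N, mem_nhdsWithin_of_mem_nhds (ho.image_mem_nhds hN), ?_⟩
      filter_upwards [hinf N hNV hNc C] with k hk
      rintro _ ⟨y, hy, rfl⟩
      exact hk y hy

theorem iterate_mem_fatouSet_iff {f : ℂ → ℂ} (hf : Continuous f) (ho : IsOpenMap f) (n : ℕ)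
    {z : ℂ} : f^[n] z ∈ fatouSet f ↔ z ∈ fatouSet f := by
  induction n with
  | zero => rfl
  | succ n ih =>
    rw [Function.iterate_succ_apply', ← ih]
    exact ⟨mem_fatouSet_of_map_mem hf, map_mem_fatouSet hf ho⟩

/-- If one point of a domain of normality escapes, the iterates tend to `∞` locally uniformly. -/
theorem IsNormalFamilyOn.tendstoInfty {f : ℂ → ℂ} {V : Set ℂ}
    (hV : IsNormalFamilyOn (fun n : ℕ => f^[n]) V) {w : ℂ} (hw : w ∈ V)
    (hesc : Tendsto (fun n : ℕ => ‖f^[n] w‖) atTop atTop) :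
    TendstoInftyLocallyUniformlyOn (fun n : ℕ => f^[n]) V := by
  intro K hK hKc C
  by_contra hcon
  obtain ⟨s, hs, hbad⟩ := extraction_of_frequently_atTop (not_eventually.mp hcon)
  obtain ⟨φ, hφ, ⟨g, hg⟩ | hinf⟩ := hV s
  · exact not_tendsto_nhds_of_tendsto_atTop
      (hesc.comp (hs.tendsto_atTop.comp hφ.tendsto_atTop)) _ (hg.tendsto_at hw).norm
  · obtain ⟨k, hk⟩ := (hinf K hK hKc C).exists
    exact hbad (φ k) hk

/-! ### Escaping domains in the Fatou set -/

section Escaping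

variable {f : ℂ → ℂ} {U : Set ℂ}

/-- If one point of a connected subset of the Fatou set escapes, so do all its points. -/
theorem tendsto_norm_iterate_of_isPreconnected (hUc : IsPreconnected U) (hUF : U ⊆ fatouSet f)
    {z w : ℂ} (hz : z ∈ U) (hw : w ∈ U) (hesc : Tendsto (fun n : ℕ => ‖f^[n] z‖) atTop atTop) :
    Tendsto (fun n : ℕ => ‖f^[n] w‖) atTop atTop := by
  have aux : ∀ V : Set ℂ, IsNormalFamilyOn (fun n : ℕ => f^[n]) V → ∀ x ∈ V, ∀ y ∈ V,
      Tendsto (fun n : ℕ => ‖f^[n] x‖) atTop atTop →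
      Tendsto (fun n : ℕ => ‖f^[n] y‖) atTop atTop := by
    intro V hV x hx y hy h
    rw [tendsto_atTop]
    intro C
    filter_upwards [hV.tendstoInfty hx h {y} (singleton_subset_iff.mpr hy) isCompact_singleton C]
      with n hn using hn y rfl
  refine hUc.induction₂' (fun x y => Tendsto (fun n : ℕ => ‖f^[n] x‖) atTop atTop →
    Tendsto (fun n : ℕ => ‖f^[n] y‖) atTop atTop) (fun x hx => ?_)
    (fun x y v _ _ _ h1 h2 h => h2 (h1 h)) hz hw hesc
  obtain ⟨V, hVo, -, hxV, hV⟩ := hUF hx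
  filter_upwards [mem_nhdsWithin_of_mem_nhds (hVo.mem_nhds hxV)] with y hy
  exact ⟨aux V hV x hxV y hy, aux V hV y hy x hxV⟩

theorem eventually_le_norm_iterate (hUc : IsPreconnected U) (hUF : U ⊆ fatouSet f)
    {z : ℂ} (hz : z ∈ U) (hesc : Tendsto (fun n : ℕ => ‖f^[n] z‖) atTop atTop) :
    TendstoInftyLocallyUniformlyOn (fun n : ℕ => f^[n]) U := by
  intro K hK hKc C
  refine hKc.induction_on (p := fun s => ∀ᶠ k : ℕ in atTop, ∀ w ∈ s, C ≤ ‖f^[k] w‖)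
    (by simp) (fun a b hab hb => ?_) (fun a b ha hb => ?_) fun w hw => ?_
  · filter_upwards [hb] with k hk w hw using hk w (hab hw)
  · filter_upwards [ha, hb] with k h1 h2 w hw using hw.elim (h1 w) (h2 w)
  · obtain ⟨V, hVo, -, hwV, hV⟩ := hUF (hK hw)
    obtain ⟨N, hN, hNV, hNc⟩ := LocallyCompactSpace.local_compact_nhds w V (hVo.mem_nhds hwV)
    exact ⟨N, mem_nhdsWithin_of_mem_nhds hN, hV.tendstoInfty hwV
      (tendsto_norm_iterate_of_isPreconnected hUc hUF hz (hK hw) hesc) N hNV hNc C⟩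

/-- Logarithms of the moduli of iterates at two points of an escaping domain in the Fatou set are
comparable. -/
theorem exists_log_norm_iterate_le (hf : Differentiable ℂ f) (hUo : IsOpen U)
    (hUc : IsPreconnected U) (hUF : U ⊆ fatouSet f)
    {z₀ : ℂ} (hz₀ : z₀ ∈ U) (hesc : Tendsto (fun n : ℕ => ‖f^[n] z₀‖) atTop atTop)
    {z w : ℂ} (hz : z ∈ U) (hw : w ∈ U) :
    ∃ C : ℝ, 0 < C ∧ ∀ᶠ n : ℕ in atTop, Real.log ‖f^[n] z‖ ≤ C * Real.log ‖f^[n] w‖ := by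
  refine hUc.induction₂' (fun x y => ∃ C : ℝ, 0 < C ∧ ∀ᶠ n : ℕ in atTop,
    Real.log ‖f^[n] x‖ ≤ C * Real.log ‖f^[n] y‖) (fun a ha => ?_) ?_ hz hw
  · obtain ⟨r, hr, hball⟩ := Metric.nhds_basis_closedBall.mem_iff.mp (hUo.mem_nhds ha)
    have hlog : ∀ b ∈ Metric.ball a (r / 2), ∀ᶠ n : ℕ in atTop,
        Real.log ‖f^[n] b‖ ≤ 3 * Real.log ‖f^[n] a‖ ∧
          Real.log ‖f^[n] a‖ ≤ 3 * Real.log ‖f^[n] b‖ := by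
      intro b hb
      filter_upwards [eventually_le_norm_iterate hUc hUF hz₀ hesc _ hball
        (isCompact_closedBall a r) 2] with n hn
      have hn' : ∀ y ∈ Metric.ball a r, 2 ≤ ‖f^[n] y‖ := fun y hy =>
        hn y (Metric.ball_subset_closedBall hy)
      -- The real part of `h` is log |f^n|, positive since |f^n| ≥ 2 on the disc, so Harnack applies
      -- with a constant independent of n.
      obtain ⟨h, hd, he⟩ := exists_differentiableOn_exp_eq Metric.isOpen_ball
        (isSimplyConnected_ball a hr) (hf.iterate n).differentiableOn (fun y hy h0 => by
          have := hn' y hy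
          rw [h0, norm_zero] at this
          norm_num at this)
      have hre : ∀ y ∈ Metric.ball a r, (h y).re = Real.log ‖f^[n] y‖ := fun y hy => by
        rw [← he y hy, Complex.norm_exp, Real.log_exp]
      have := harnack_re hd (fun y hy => by
        rw [hre y hy]
        exact Real.log_pos (by linarith [hn' y hy])) hb
      rwa [hre b (Metric.ball_subset_ball (by linarith) hb),
        hre a (Metric.mem_ball_self hr)] at this
    filter_upwards [mem_nhdsWithin_of_mem_nhds (Metric.ball_mem_nhds a (half_pos hr))] with b hb
    exact ⟨⟨3, by norm_num, (hlog b hb).mono fun n hn => hn.2⟩,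
      ⟨3, by norm_num, (hlog b hb).mono fun n hn => hn.1⟩⟩
  · rintro x y v - - - ⟨C, hC, h1⟩ ⟨D, hD, h2⟩
    refine ⟨C * D, mul_pos hC hD, ?_⟩
    filter_upwards [h1, h2] with n h1 h2
    rw [mul_assoc]
    exact h1.trans (mul_le_mul_of_nonneg_left h2 hC.le)

end Escaping

/-! ### Levels of the fast escaping set -/

section FastEscaping

variable {f : ℂ → ℂ} {R : ℝ} {U : Set ℂ}

theorem fastEscapingLevel_subset (hM : ∀ r : ℝ, R ≤ r → r < maxModulus f r) (L : ℤ) :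
    fastEscapingLevel f R L ⊆ fastEscapingSet f R := by
  intro z hz
  -- Since |L| + L ≥ 0, the shift |L| serves both signs of L, and monotonicity absorbs the surplus.
  refine ⟨L.natAbs, fun n => ?_⟩
  refine (monotone_maxModulus_iterate hM ?_).trans (hz (n + L.natAbs) (by omega))
  omega

theorem exists_mem_fastEscapingLevel {z : ℂ} (hz : z ∈ fastEscapingSet f R) :
    ∃ L : ℤ, z ∈ fastEscapingLevel f R L := by
  obtain ⟨l, hl⟩ := hz
  refine ⟨-l, fun n hn => ?_⟩
  obtain ⟨k, rfl⟩ : ∃ k, n = k + l := ⟨n - l, by omega⟩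
  have e : (((k + l : ℕ) : ℤ) + -(l : ℤ)).toNat = k := by omega
  rw [e]
  exact hl k

theorem tendsto_norm_iterate_of_mem_fastEscapingSet (hf : Differentiable ℂ f) (hR : 0 < R)
    (hM : ∀ r : ℝ, R ≤ r → r < maxModulus f r) {z : ℂ} (hz : z ∈ fastEscapingSet f R) :
    Tendsto (fun n : ℕ => ‖f^[n] z‖) atTop atTop := by
  obtain ⟨l, hl⟩ := hz
  rw [← tendsto_add_atTop_iff_nat l]
  exact tendsto_atTop_mono hl (tendsto_maxModulus_iterate hf hR hM)

/-- If a point fails to lie in a level of the fast escaping set, its orbit is eventually dominated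
by the corresponding sequence of maximum moduli. -/
theorem exists_norm_iterate_lt_of_notMem_fastEscapingLevel (hf : Differentiable ℂ f)
    (ho : IsOpenMap f) {L : ℤ} {z : ℂ} (hz : z ∉ fastEscapingLevel f R L) :
    ∃ n m : ℕ, (n : ℤ) + L = m ∧
      ∀ k, ‖f^[k + n] z‖ < (maxModulus f)^[k + m] R := by
  simp only [fastEscapingLevel, mem_ofPred_eq, not_forall, not_le] at hz
  obtain ⟨n, hn, hlt⟩ := hz
  refine ⟨n, ((n : ℤ) + L).toNat, by omega, fun k => ?_⟩
  rw [Function.iterate_add_apply, Function.iterate_add_apply]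
  exact norm_iterate_lt_maxModulus_iterate hf ho hlt k

theorem le_norm_iterate_of_mem_fastEscapingLevel {L : ℤ} {z : ℂ}
    (hz : z ∈ fastEscapingLevel f R L) {n m : ℕ} (h : (n : ℤ) + L = m) :
    (maxModulus f)^[m] R ≤ ‖f^[n] z‖ := by
  have := hz n (by omega)
  rwa [h, Int.toNat_natCast] at this

/-- The loss of one level pays for Harnack's constant: one extra application of M raises a large
radius to a power exceeding C, whereas logarithms at two points differ by at most the factor C. -/
theorem subset_fastEscapingLevel_sub_one (hf : IsTranscendentalEntire f) (hR : 0 < R)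
    (hM : ∀ r : ℝ, R ≤ r → r < maxModulus f r) (hUo : IsOpen U) (hUc : IsPreconnected U)
    (hUF : U ⊆ fatouSet f) {L : ℤ} (hL : (U ∩ fastEscapingLevel f R L).Nonempty) :
    U ⊆ fastEscapingLevel f R (L - 1) := by
  obtain ⟨z₀, hz₀, hz₀L⟩ := hL
  intro z hz
  by_contra hcon
  have hesc := tendsto_norm_iterate_of_mem_fastEscapingSet hf.1 hR hM
    (fastEscapingLevel_subset hM L hz₀L)
  obtain ⟨n, m, hnm, hlt⟩ :=
    exists_norm_iterate_lt_of_notMem_fastEscapingLevel hf.1 hf.isOpenMap hcon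
  obtain ⟨C, hC, hlog⟩ := exists_log_norm_iterate_le hf.1 hUo hUc hUF hz₀ hesc hz₀ hz
  obtain ⟨K, hK⟩ := exists_nat_gt C
  have hMt : Tendsto (fun k : ℕ => (maxModulus f)^[k + m] R) atTop atTop :=
    (tendsto_add_atTop_iff_nat m).mpr (tendsto_maxModulus_iterate hf.1 hR hM)
  have hesz := tendsto_norm_iterate_of_isPreconnected hUc hUF hz₀ hz hesc
  obtain ⟨k, h1, h2, h3, h4⟩ := (((tendsto_add_atTop_nat n).eventually hlog).and
    ((hMt.eventually (hf.eventually_pow_le_maxModulus K)).and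
    ((hMt.eventually (eventually_gt_atTop 1)).and
    ((tendsto_add_atTop_nat n).eventually (hesz.eventually (eventually_gt_atTop 0)))))).exists
  set a := (maxModulus f)^[k + m] R with ha
  have h5 : maxModulus f a ≤ ‖f^[k + n] z₀‖ := by
    have := le_norm_iterate_of_mem_fastEscapingLevel hz₀L (n := k + n) (m := k + m + 1)
      (by push_cast; linarith)
    rwa [Function.iterate_succ_apply'] at this
  have h6 : K * Real.log a ≤ Real.log ‖f^[k + n] z₀‖ := by
    rw [← Real.log_pow]
    exact Real.log_le_log (pow_pos (by linarith) K) (h2.trans h5)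
  have h7 : Real.log ‖f^[k + n] z‖ ≤ Real.log a := Real.log_le_log h4 (hlt k).le
  have h8 : 0 < Real.log a := Real.log_pos h3
  have h9 := mul_le_mul_of_nonneg_left h7 hC.le
  have h10 := mul_lt_mul_of_pos_right hK h8
  linarith

/-- A domain in the Fatou set that meets the fast escaping set is wandering. -/
theorem iterate_notMem_of_fastEscaping (hf : IsTranscendentalEntire f) (hR : 0 < R)
    (hM : ∀ r : ℝ, R ≤ r → r < maxModulus f r) (hUo : IsOpen U) (hUc : IsPreconnected U)
    (hUF : U ⊆ fatouSet f) (hA : (U ∩ fastEscapingSet f R).Nonempty) {z : ℂ} (hz : z ∈ U)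
    {n : ℕ} (hn : n ≠ 0) : f^[n] z ∉ U := by
  intro hnz
  obtain ⟨z₀, hz₀, hz₀A⟩ := hA
  obtain ⟨L, hL⟩ := exists_mem_fastEscapingLevel hz₀A
  obtain ⟨l, hl⟩ := fastEscapingLevel_subset hM _
    (subset_fastEscapingLevel_sub_one hf hR hM hUo hUc hUF ⟨z₀, hz₀, hL⟩ hz)
  -- If f^n z returned to `U`, comparing it with `z` would let log |f^k z| grow by at most a factor
  -- C per n steps. Fast escape forces a factor K > C at every step, and (K/C)^j is unbounded.
  obtain ⟨C, hC, hlog⟩ := exists_log_norm_iterate_le hf.1 hUo hUc hUF hz₀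
    (tendsto_norm_iterate_of_mem_fastEscapingSet hf.1 hR hM hz₀A) hnz hz
  obtain ⟨K, hK⟩ := exists_nat_gt C
  have hMt := tendsto_maxModulus_iterate hf.1 hR hM
  obtain ⟨i₀, hi₀⟩ := eventually_atTop.mp (((hMt.eventually
    (hf.eventually_pow_le_maxModulus K)).and (hMt.eventually (eventually_gt_atTop 1))).and
    ((tendsto_add_atTop_nat l).eventually hlog))
  have hlow : ∀ j : ℕ, (K : ℝ) ^ j * Real.log ((maxModulus f)^[i₀] R) ≤
      Real.log ((maxModulus f)^[i₀ + j] R) := by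
    intro j
    induction j with
    | zero => simp
    | succ j ih =>
      obtain ⟨⟨h1, h2⟩, -⟩ := hi₀ (i₀ + j) (Nat.le_add_right _ _)
      rw [← add_assoc, Function.iterate_succ_apply']
      refine le_trans ?_ (Real.log_le_log (pow_pos (by linarith) K) h1)
      rw [Real.log_pow, pow_succ']
      rw [mul_assoc]
      exact mul_le_mul_of_nonneg_left ih (Nat.cast_nonneg K)
  have hup : ∀ j : ℕ, Real.log ‖f^[i₀ + j * n + l] z‖ ≤ C ^ j * Real.log ‖f^[i₀ + l] z‖ := by
    intro j
    induction j with
    | zero => simp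
    | succ j ih =>
      have h1 := (hi₀ (i₀ + j * n) (Nat.le_add_right _ _)).2
      rw [← Function.iterate_add_apply] at h1
      have e : i₀ + (j + 1) * n + l = i₀ + j * n + l + n := by ring
      rw [e, pow_succ', mul_assoc]
      exact h1.trans (mul_le_mul_of_nonneg_left ih hC.le)
  have hcmp : ∀ j : ℕ, (K : ℝ) ^ j * Real.log ((maxModulus f)^[i₀] R) ≤
      C ^ j * Real.log ‖f^[i₀ + l] z‖ := by
    intro j
    refine (hlow j).trans (le_trans ?_ (hup j))
    have hpos : 0 < (maxModulus f)^[i₀ + j] R := by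
      linarith [(hi₀ (i₀ + j) (Nat.le_add_right _ _)).1.2]
    refine Real.log_le_log hpos ((monotone_maxModulus_iterate hM ?_).trans (hl (i₀ + j * n)))
    have := Nat.le_mul_of_pos_right j (Nat.pos_of_ne_zero hn)
    omega
  have hlogpos : 0 < Real.log ((maxModulus f)^[i₀] R) := Real.log_pos (hi₀ i₀ le_rfl).1.2
  have hratio : Tendsto (fun j : ℕ => ((K : ℝ) / C) ^ j) atTop atTop :=
    tendsto_pow_atTop_atTop_of_one_lt ((one_lt_div hC).mpr hK)
  obtain ⟨j, hj⟩ := (hratio.eventually (eventually_gt_atTop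
    (Real.log ‖f^[i₀ + l] z‖ / Real.log ((maxModulus f)^[i₀] R)))).exists
  rw [div_pow, div_lt_div_iff₀ hlogpos (pow_pos hC j)] at hj
  linarith [hcmp j]

end FastEscaping

/-! ### Simply connected fast escaping components -/

section Components

variable {f : ℂ → ℂ} {R : ℝ} {U : Set ℂ}

theorem IsFatouComponent.isOpen (hU : IsFatouComponent f U) : IsOpen U := by
  obtain ⟨z, -, rfl⟩ := hU
  exact (isOpen_fatouSet f).connectedComponentIn

theorem IsFatouComponent.isPreconnected (hU : IsFatouComponent f U) : IsPreconnected U := by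
  obtain ⟨z, -, rfl⟩ := hU
  exact isPreconnected_connectedComponentIn

theorem IsFatouComponent.subset (hU : IsFatouComponent f U) : U ⊆ fatouSet f := by
  obtain ⟨z, -, rfl⟩ := hU
  exact connectedComponentIn_subset _ _

theorem IsFatouComponent.nonempty (hU : IsFatouComponent f U) : U.Nonempty := by
  obtain ⟨z, hz, rfl⟩ := hU
  exact ⟨z, mem_connectedComponentIn hz⟩

theorem IsFatouComponent.subset_of_isPreconnected (hU : IsFatouComponent f U) {V : Set ℂ}
    (hV : IsPreconnected V) (hVF : V ⊆ fatouSet f) (h : (U ∩ V).Nonempty) : V ⊆ U := by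
  obtain ⟨z, -, rfl⟩ := hU
  obtain ⟨w, hw, hwV⟩ := h
  rw [connectedComponentIn_eq hw]
  exact hV.subset_connectedComponentIn hwV hVF

/-- The component of such a point is an open neighbourhood of it, so it meets `U` and lies in `U`.
-/
theorem IsFatouComponent.closure_inter_subset (hU : IsFatouComponent f U) :
    closure U ∩ fatouSet f ⊆ U := by
  rintro z ⟨hz, hzF⟩
  have hzV := mem_connectedComponentIn hzF
  have hne := mem_closure_iff.mp hz _ (isOpen_fatouSet f).connectedComponentIn hzV
  exact hU.subset_of_isPreconnected isPreconnected_connectedComponentIn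
    (connectedComponentIn_subset _ _) (inter_comm U _ ▸ hne) hzV

theorem IsFatouComponent.disjoint_image_iterate (hf : IsTranscendentalEntire f) (hR : 0 < R)
    (hM : ∀ r : ℝ, R ≤ r → r < maxModulus f r) (hU : IsFatouComponent f U)
    (hA : (U ∩ fastEscapingSet f R).Nonempty) {n : ℕ} (hn : n ≠ 0) : Disjoint U (f^[n] '' U) := by
  rw [disjoint_right]
  rintro _ ⟨z, hz, rfl⟩
  exact iterate_notMem_of_fastEscaping hf hR hM hU.isOpen hU.isPreconnected hU.subset hA hz hn

/-- Otherwise `U` is the whole plane and meets its own image. Such a point is omitted by every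
iterate on `U`, which makes f^n - p nonvanishing there. -/
theorem exists_notMem_fatouSet (hf : IsTranscendentalEntire f) (hR : 0 < R)
    (hM : ∀ r : ℝ, R ≤ r → r < maxModulus f r) (hU : IsFatouComponent f U)
    (hA : (U ∩ fastEscapingSet f R).Nonempty) : ∃ p, p ∉ fatouSet f := by
  by_contra! hcon
  have huniv : univ ⊆ U := hU.subset_of_isPreconnected isPreconnected_univ (fun z _ => hcon z)
    (by simpa using hU.nonempty)
  exact disjoint_right.mp (hU.disjoint_image_iterate hf hR hM hA one_ne_zero)
    (mem_image_of_mem _ (huniv (mem_univ 0))) (huniv (mem_univ _))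

/-- The iterated images of a simply connected fast escaping Fatou component do not contain large
circles centred at a point of the Julia set. -/
theorem IsFatouComponent.not_sphere_subset_image (hf : IsTranscendentalEntire f) (hR : 0 < R)
    (hM : ∀ r : ℝ, R ≤ r → r < maxModulus f r) (hU : IsFatouComponent f U)
    (hA : (U ∩ fastEscapingSet f R).Nonempty) (hsc : IsSimplyConnected U) {n : ℕ} (hn : n ≠ 0)
    {p a : ℂ} (hp : p ∉ fatouSet f) (ha : a ∈ U) {s : ℝ} (hs : ‖a - p‖ < s) :
    ¬ Metric.sphere p s ⊆ f^[n] '' U := by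
  intro hsub
  have hdisj := disjoint_right.mp (hU.disjoint_image_iterate hf hR hM hA hn)
  -- The circle lies in f^n(U), which is disjoint from `U`; being connected and containing the inner
  -- point `a`, `U` cannot cross it.
  have hbdd : U ⊆ Metric.ball p s := by
    intro b hb
    by_contra hbs
    rw [Metric.mem_ball, not_lt, dist_eq_norm] at hbs
    obtain ⟨c, hc, hcs⟩ := hU.isPreconnected.intermediate_value ha hb
      (f := fun z => ‖z - p‖) (by fun_prop) ⟨hs.le, hbs⟩
    exact hdisj (hsub (by rw [Metric.mem_sphere, dist_eq_norm]; exact hcs)) hc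
  have hcont := hf.1.continuous.iterate n
  have hmem : ∀ z ∈ U, f^[n] z ∈ fatouSet f := fun z hz =>
    (iterate_mem_fatouSet_iff hf.1.continuous hf.isOpenMap n).mpr (hU.subset hz)
  have hs0 : 0 ≤ s := (norm_nonneg _).trans hs.le
  refine not_isCompact_norm_level hU.isOpen hsc (g := fun z => f^[n] z - p) (s := s)
    ((hf.1.iterate n).sub_const p).differentiableOn
    (fun z hz h0 => hp (sub_eq_zero.mp h0 ▸ hmem z hz)) ?_ ?_
  · obtain ⟨w, hw⟩ : (Metric.sphere p s).Nonempty := NormedSpace.sphere_nonempty.mpr hs0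
    obtain ⟨z, hz, rfl⟩ := hsub hw
    exact ⟨z, hz, by rwa [Metric.mem_sphere, dist_eq_norm] at hw⟩
  -- Compactness: a point of the closure mapped into the circle lands in the Fatou set, so by
  -- backward invariance it is a Fatou point, hence in `U`.
  · have e : {z ∈ U | ‖f^[n] z - p‖ = s} = closure U ∩ {z | ‖f^[n] z - p‖ = s} := by
      refine Subset.antisymm (fun z hz => ⟨subset_closure hz.1, hz.2⟩) ?_
      rintro z ⟨hz, hzs⟩
      refine ⟨hU.closure_inter_subset ⟨hz, ?_⟩, hzs⟩
      rw [← iterate_mem_fatouSet_iff hf.1.continuous hf.isOpenMap n]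
      obtain ⟨y, hy, hyz⟩ := hsub (show f^[n] z ∈ Metric.sphere p s by
        rw [Metric.mem_sphere, dist_eq_norm]; exact hzs)
      exact hyz ▸ hmem y hy
    rw [e]
    exact (Metric.isBounded_ball.subset hbdd).isCompact_closure.inter_right
      (isClosed_eq (hcont.sub continuous_const).norm continuous_const)

/-- Iterates have bounded distortion on simply connected fast escaping Fatou components. -/
theorem IsFatouComponent.exists_norm_iterate_le (hf : IsTranscendentalEntire f) (hR : 0 < R)
    (hM : ∀ r : ℝ, R ≤ r → r < maxModulus f r) (hU : IsFatouComponent f U)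
    (hA : (U ∩ fastEscapingSet f R).Nonempty) (hsc : IsSimplyConnected U)
    {z w : ℂ} (hz : z ∈ U) (hw : w ∈ U) :
    ∃ C : ℝ, 0 < C ∧ ∀ᶠ n : ℕ in atTop, ‖f^[n] z‖ ≤ C * ‖f^[n] w‖ := by
  obtain ⟨p, hp⟩ := exists_notMem_fatouSet hf hR hM hU hA
  have hunif : TendstoInftyLocallyUniformlyOn (fun n : ℕ => f^[n]) U := by
    obtain ⟨z₀, hz₀, hz₀A⟩ := hA
    exact eventually_le_norm_iterate hU.isPreconnected hU.subset hz₀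
      (tendsto_norm_iterate_of_mem_fastEscapingSet hf.1 hR hM hz₀A)
  refine hU.isPreconnected.induction₂' (fun x y => ∃ C : ℝ, 0 < C ∧ ∀ᶠ n : ℕ in atTop,
    ‖f^[n] x‖ ≤ C * ‖f^[n] y‖) (fun a ha => ?_) ?_ hz hw
  · obtain ⟨r, hr, hball⟩ := Metric.nhds_basis_closedBall.mem_iff.mp (hU.isOpen.mem_nhds ha)
    set E := Real.exp 384 with hE
    have hE0 : 0 < E := Real.exp_pos _
    have hlog : ∀ b ∈ Metric.ball a (r / 2), ∀ᶠ n : ℕ in atTop,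
        ‖f^[n] b‖ ≤ 3 * E * ‖f^[n] a‖ ∧ ‖f^[n] a‖ ≤ 3 * E * ‖f^[n] b‖ := by
      intro b hb
      -- This threshold makes |f^n - p| exceed |a - p|, as excluding the circle requires, and lie
      -- between 1/2 and 3/2 times |f^n|. The latter transfers the distortion bound from f^n - p to
      -- f^n.
      filter_upwards [hunif _ hball (isCompact_closedBall a r) (2 * ‖p‖ + ‖a - p‖ + 1),
        eventually_ne_atTop 0] with n hn hn0
      have hr2 : 2 * (r / 2) = r := by ring
      have hn' : ∀ y ∈ Metric.ball a (2 * (r / 2)), 2 * ‖p‖ + ‖a - p‖ + 1 ≤ ‖f^[n] y‖ :=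
        fun y hy => hn y (Metric.ball_subset_closedBall (hr2 ▸ hy))
      have hlt : ∀ y ∈ Metric.ball a (2 * (r / 2)), ‖a - p‖ < ‖f^[n] y - p‖ := fun y hy => by
        linarith [hn' y hy, norm_sub_norm_le (f^[n] y) p, norm_nonneg p]
      have hlo : ∀ y ∈ Metric.ball a (2 * (r / 2)), ‖f^[n] y‖ ≤ 2 * ‖f^[n] y - p‖ :=
        fun y hy => by
          linarith [hn' y hy, norm_sub_norm_le (f^[n] y) p, norm_nonneg (a - p)]
      have hhi : ∀ y ∈ Metric.ball a (2 * (r / 2)), 2 * ‖f^[n] y - p‖ ≤ 3 * ‖f^[n] y‖ :=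
        fun y hy => by
          linarith [hn' y hy, norm_sub_le (f^[n] y) p, norm_nonneg (a - p)]
      have haB : a ∈ Metric.ball a (2 * (r / 2)) := Metric.mem_ball_self (by linarith)
      have hbB : b ∈ Metric.ball a (2 * (r / 2)) := Metric.ball_subset_ball (by linarith) hb
      rcases sphere_subset_image_or_norm_le (g := fun y => f^[n] y - p) (half_pos hr)
        ((hf.1.iterate n).sub_const p).differentiableOn
        (fun y hy => norm_pos_iff.mp ((norm_nonneg _).trans_lt (hlt y hy))) with
        ⟨y, hy, hsph⟩ | hdist
      · refine absurd ?_ (hU.not_sphere_subset_image hf hR hM hA hsc hn0 hp ha (hlt y hy))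
        intro v hv
        obtain ⟨x, hx, hxv⟩ := hsph (show v - p ∈ Metric.sphere 0 ‖f^[n] y - p‖ by
          rw [mem_sphere_zero_iff_norm, ← dist_eq_norm]; exact hv)
        exact ⟨x, hball (Metric.ball_subset_closedBall (hr2 ▸ hx)), sub_left_injective hxv⟩
      · obtain ⟨h1, h2⟩ := hdist b hb
        constructor
        · calc ‖f^[n] b‖ ≤ 2 * ‖f^[n] b - p‖ := hlo b hbB
            _ ≤ 2 * (E * ‖f^[n] a - p‖) := by gcongr
            _ = E * (2 * ‖f^[n] a - p‖) := by ring
            _ ≤ E * (3 * ‖f^[n] a‖) := mul_le_mul_of_nonneg_left (hhi a haB) hE0.le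
            _ = 3 * E * ‖f^[n] a‖ := by ring
        · calc ‖f^[n] a‖ ≤ 2 * ‖f^[n] a - p‖ := hlo a haB
            _ ≤ 2 * (E * ‖f^[n] b - p‖) := by gcongr
            _ = E * (2 * ‖f^[n] b - p‖) := by ring
            _ ≤ E * (3 * ‖f^[n] b‖) := mul_le_mul_of_nonneg_left (hhi b hbB) hE0.le
            _ = 3 * E * ‖f^[n] b‖ := by ring
    filter_upwards [mem_nhdsWithin_of_mem_nhds (Metric.ball_mem_nhds a (half_pos hr))] with b hb
    exact ⟨⟨3 * E, by positivity, (hlog b hb).mono fun n hn => hn.2⟩,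
      ⟨3 * E, by positivity, (hlog b hb).mono fun n hn => hn.1⟩⟩
  · rintro x y v - - - ⟨C, hC, h1⟩ ⟨D, hD, h2⟩
    refine ⟨C * D, mul_pos hC hD, ?_⟩
    filter_upwards [h1, h2] with n h1 h2
    rw [mul_assoc]
    exact h1.trans (mul_le_mul_of_nonneg_left h2 hC.le)

/-- No level is lost, because a fixed multiplicative gap below M^k(R) cannot persist: quadratic
growth of M drives the relative size of a lower orbit to 0, against bounded distortion. -/
theorem IsFatouComponent.subset_fastEscapingLevel (hf : IsTranscendentalEntire f) (hR : 0 < R)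
    (hM : ∀ r : ℝ, R ≤ r → r < maxModulus f r) (hU : IsFatouComponent f U)
    (hsc : IsSimplyConnected U) {L : ℤ} (hL : (U ∩ fastEscapingLevel f R L).Nonempty) :
    U ⊆ fastEscapingLevel f R L := by
  have hA := hL.mono (inter_subset_inter_right U (fastEscapingLevel_subset hM L))
  obtain ⟨z₀, hz₀, hz₀L⟩ := hL
  intro z hz
  by_contra hcon
  have hesc := tendsto_norm_iterate_of_mem_fastEscapingSet hf.1 hR hM
    (fastEscapingLevel_subset hM L hz₀L)
  obtain ⟨n, m, hnm, hlt⟩ :=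
    exists_norm_iterate_lt_of_notMem_fastEscapingLevel hf.1 hf.isOpenMap hcon
  obtain ⟨C, hC, hdist⟩ := hU.exists_norm_iterate_le hf hR hM hA hsc hz₀ hz
  have hMt : Tendsto (fun k : ℕ => (maxModulus f)^[k + m] R) atTop atTop :=
    (tendsto_add_atTop_iff_nat m).mpr (tendsto_maxModulus_iterate hf.1 hR hM)
  have hesz := tendsto_norm_iterate_of_isPreconnected hU.isPreconnected hU.subset hz₀ hz hesc
  obtain ⟨k₀, hk₀⟩ := eventually_atTop.mp (((tendsto_add_atTop_nat n).eventually hdist).and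
    ((hMt.eventually hf.eventually_sq_mul_norm_le).and
    ((tendsto_add_atTop_nat n).eventually (hesz.eventually (eventually_ge_atTop 1)))))
  have hapos : ∀ k, 0 < (maxModulus f)^[k + m] R := fun k =>
    hR.trans_le (le_maxModulus_iterate hM _)
  -- The quotient starts below 1 and is at most squared at each step, yet stays above 1/C because
  -- the orbit of `z₀` remains at or above the same iterates of M.
  let q : ℕ → ℝ := fun j => ‖f^[k₀ + j + n] z‖ / (maxModulus f)^[k₀ + j + m] R
  have hq0 : ∀ j, 0 ≤ q j := fun j => div_nonneg (norm_nonneg _) (hapos _).le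
  have hq1 : q 0 < 1 := (div_lt_one (hapos _)).mpr (hlt k₀)
  have hstep : ∀ j, q (j + 1) ≤ q j ^ 2 := by
    intro j
    obtain ⟨-, h1, h2⟩ := hk₀ (k₀ + j) (Nat.le_add_right _ _)
    have h3 := h1 _ h2 (hlt _).le
    have e1 : k₀ + (j + 1) + n = (k₀ + j + n) + 1 := by ring
    have e2 : k₀ + (j + 1) + m = (k₀ + j + m) + 1 := by ring
    have h4 := hapos (k₀ + (j + 1))
    simp only [q]
    rw [e2] at h4
    rw [e1, e2, div_pow, div_le_div_iff₀ h4 (pow_pos (hapos _) 2), Function.iterate_succ_apply',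
      Function.iterate_succ_apply']
    linarith
  have hqpow : ∀ j, q j ≤ q 0 ^ (j + 1) := by
    intro j
    induction j with
    | zero => simp
    | succ j ih =>
      calc q (j + 1) ≤ q j ^ 2 := hstep j
        _ ≤ (q 0 ^ (j + 1)) ^ 2 := pow_le_pow_left₀ (hq0 j) ih 2
        _ = q 0 ^ ((j + 1) * 2) := (pow_mul _ _ _).symm
        _ ≤ q 0 ^ (j + 1 + 1) := pow_le_pow_of_le_one (hq0 0) hq1.le (by omega)
  have hlow : ∀ j, 1 / C ≤ q j := by
    intro j
    obtain ⟨h1, -⟩ := hk₀ (k₀ + j) (Nat.le_add_right _ _)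
    have h2 := le_norm_iterate_of_mem_fastEscapingLevel hz₀L (n := k₀ + j + n) (m := k₀ + j + m)
      (by push_cast; linarith)
    simp only [q]
    rw [div_le_div_iff₀ hC (hapos _), one_mul, mul_comm]
    exact h2.trans h1
  obtain ⟨j, hj⟩ := ((tendsto_pow_atTop_nhds_zero_of_lt_one (hq0 0) hq1).eventually
    (gt_mem_nhds (one_div_pos.mpr hC))).exists
  have h5 : q 0 ^ (j + 1) ≤ q 0 ^ j := pow_le_pow_of_le_one (hq0 0) hq1.le (Nat.le_succ j)
  linarith [hlow j, hqpow j]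

end Components

theorem theorem1p2 (f : ℂ → ℂ) (hf : IsTranscendentalEntire f) (R : ℝ) (hR : 0 < R)
    (hM : ∀ r : ℝ, R ≤ r → r < maxModulus f r) :
    (∀ (L : ℤ) (U : Set ℂ), IsFatouComponent f U → (U ∩ fastEscapingLevel f R L).Nonempty →
      closure U ⊆ fastEscapingLevel f R (L - 1) ∧
        (IsSimplyConnected U → closure U ⊆ fastEscapingLevel f R L)) ∧
    (∀ U : Set ℂ, IsFatouComponent f U → U ⊆ fastEscapingSet f R →
      frontier U ⊆ fastEscapingSet f R) := by
  have hclosed := isClosed_fastEscapingLevel hf.1.continuous R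
  have hsub : ∀ (L : ℤ) (U : Set ℂ), IsFatouComponent f U →
      (U ∩ fastEscapingLevel f R L).Nonempty → closure U ⊆ fastEscapingLevel f R (L - 1) :=
    fun L U hU hL => closure_minimal (subset_fastEscapingLevel_sub_one hf hR hM hU.isOpen
      hU.isPreconnected hU.subset hL) (hclosed _)
  refine ⟨fun L U hU hL => ⟨hsub L U hU hL, fun hsc => closure_minimal
    (hU.subset_fastEscapingLevel hf hR hM hsc hL) (hclosed _)⟩, fun U hU hUA => ?_⟩
  obtain ⟨z, hz⟩ := hU.nonempty
  obtain ⟨L, hL⟩ := exists_mem_fastEscapingLevel (hUA hz)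
  exact frontier_subset_closure.trans
    ((hsub L U hU ⟨z, hz, hL⟩).trans (fastEscapingLevel_subset hM _))
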